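/- Let $X\in\mathbb R^{n\times p}$, $y\in\mathbb R^n$, $\lambda,\mu\ge 0$, $k\in\mathbb Z_{\ge 0}$, let $T_1,\dots,T_m\subseteq\{1,\dots,p\}$, and put $Q=X^\top X+\lambda I$. Assume that $k\ge 1$ or that $Q$ is positive definite. For $z\in[0,1]^p$ write $z(T)=\sum_{i\in T}z_i$, and for $\beta\in\mathbb R^p$ let $$\varphi(z,\beta)=\max_{A_1,\dots,A_m,R}\Big\{\beta^\top R\beta+\sum_{h=1}^m\frac{\beta^\top A_h\beta}{\min\{1,z(T_h)\}}\Big\}\in\mathbb R\cup\{+\infty\},$$ where the maximum (supremum) is over all positive semidefinite $p\times p$ matrices $A_1,\dots,A_m,R$ with $\sum_h A_h+R=Q$ and $(A_h)_{ij}=0$ whenever $i\notin T_h$ or $j\notin T_h$, and where $0/0=0$ and $s/0=+\infty$ for $s>0$. Consider the relaxation $$\text{(P)}\quad y^\top y+\min_{\beta,z,u}\; -2y^\top X\beta+\mu\, e^\top u+\varphi(z,\beta)\quad\text{s.t. } e^\top z\le k,\ \beta\le u,\ -\beta\le u,\ z\in[0,1]^p,\ u\in\mathbb R_+^p$$ and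 the semidefinite program $$\text{(S)}\quad y^\top y+\min_{\beta,z,u,w,B}\; -2y^\top X\beta+\mu\, e^\top u+\langle Q,B\rangle$$ subject to the same constraints on $(\beta,z,u)$ and $$w\in[0,1]^m,\quad w_h\le z(T_h),\quad w_hB_{T_h}-\beta_{T_h}\beta_{T_h}^\top\succeq 0\ \ (h=1,\dots,m),\quad B-\beta\beta^\top\succeq 0 ,$$ where $B_{T}$, $\beta_{T}$ denote the submatrix and subvector indexed by $T$. Then (P) and (S) are equivalent in the following sense. (1) Their optimal values (infima) are equal. (2) If $(\beta,z,u,w,B)$ is feasible for (S), then $(\beta,z,u)$ is feasible for (P) and its objective value in (P) is at most that of $(\beta,z,u,w,B)$ in (S). (3) For all $\beta\in\mathbb R^p$ and $z\in[0,1]^p$ such that $Q$ is positive definite or $\beta_{T_h}=0$ for every $h$ with $z(T_h)=0$, $\varphi(z,\beta)$ is the infimum of $\langle Q,B\rangle$ over all $(w,B)$ that satisfy the last four constraints of (S) (the infimum of the empty set being $+\infty$). (4) A point $(\beta,z,u,w,B)$ is optimal for (S) if and only if it is feasible for (S), $(\beta,z,u)$ is optimal for (P), and $\langle Q,B\rangle=\varphi(z,\beta)$.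 (5) If $Q$ is positive definite, then every optimal solution $(\beta,z,u)$ of (P) can be completed by some $(w,B)$ to an optimal solution of (S). -/

import Mathlib

open scoped Matrix

noncomputable section

namespace SparseReg

/-- Division `s / t` of a nonnegative number `s` by a nonnegative number `t`, with the conventions
`0 / 0 = 0` and `s / 0 = +∞` for `s > 0`. -/
def extDiv (s t : ℝ) : EReal :=
  if t = 0 then (if s = 0 then 0 else ⊤) else ((s / t : ℝ) : EReal)

/-- The matrix `XᵀX + λ I`. -/
def gram {n p : ℕ} (X : Matrix (Fin n) (Fin p) ℝ) (lam : ℝ) : Matrix (Fin p) (Fin p) ℝ :=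
  Xᵀ * X + lam • (1 : Matrix (Fin p) (Fin p) ℝ)

/-- The quadratic form `βᵀ M β`. -/
def quad {p : ℕ} (M : Matrix (Fin p) (Fin p) ℝ) (β : Fin p → ℝ) : ℝ :=
  β ⬝ᵥ (M *ᵥ β)

/-- `(A, R)` decomposes `Q` as `∑ h, A h + R`, where all matrices are positive semidefinite and
`A h` vanishes outside `T h × T h`. -/
structure IsDecomp {p m : ℕ} (Q : Matrix (Fin p) (Fin p) ℝ) (T : Fin m → Finset (Fin p))
    (A : Fin m → Matrix (Fin p) (Fin p) ℝ) (R : Matrix (Fin p) (Fin p) ℝ) : Prop where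
  sum_eq : ∑ h, A h + R = Q
  support : ∀ h i j, i ∉ T h ∨ j ∉ T h → A h i j = 0
  psd : ∀ h, (A h).PosSemidef
  psd_rem : R.PosSemidef

/-- The value `βᵀ R β + ∑ h, βᵀ (A h) β / min {1, z (T h)}` of a decomposition. -/
def decompValue {p m : ℕ} (T : Fin m → Finset (Fin p)) (z β : Fin p → ℝ)
    (A : Fin m → Matrix (Fin p) (Fin p) ℝ) (R : Matrix (Fin p) (Fin p) ℝ) : EReal :=
  ((quad R β : ℝ) : EReal) + ∑ h, extDiv (quad (A h) β) (min 1 (∑ i ∈ T h, z i))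

/-- `φ(z, β)`: the largest value of a decomposition of `Q` (possibly `+∞`). -/
def phi {p m : ℕ} (Q : Matrix (Fin p) (Fin p) ℝ) (T : Fin m → Finset (Fin p))
    (z β : Fin p → ℝ) : EReal :=
  ⨆ (A : Fin m → Matrix (Fin p) (Fin p) ℝ) (R : Matrix (Fin p) (Fin p) ℝ)
    (_ : IsDecomp Q T A R), decompValue T z β A R

/-- The variables `(β, z, u)`. -/
structure Point (p : ℕ) where
  β : Fin p → ℝ
  z : Fin p → ℝ
  u : Fin p → ℝ

/-- Cardinality, absolute value and bound constraints on `(β, z, u)`. -/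
structure Feasible {p : ℕ} (k : ℕ) (a : Point p) : Prop where
  card : ∑ i, a.z i ≤ k
  le_u : ∀ i, a.β i ≤ a.u i
  neg_le_u : ∀ i, -a.β i ≤ a.u i
  z_mem : ∀ i, a.z i ∈ Set.Icc (0 : ℝ) 1
  u_nonneg : ∀ i, 0 ≤ a.u i

/-- The part `yᵀy - 2 yᵀXβ + μ eᵀu` common to both objectives. -/
def linPart {n p : ℕ} (X : Matrix (Fin n) (Fin p) ℝ) (y : Fin n → ℝ) (mu : ℝ) (a : Point p) : ℝ :=
  y ⬝ᵥ y - 2 * (y ⬝ᵥ (X *ᵥ a.β)) + mu * ∑ i, a.u i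

/-- The objective `yᵀy - 2 yᵀXβ + μ eᵀu + φ(z, β)` of the relaxation. -/
def relaxObj {n p m : ℕ} (X : Matrix (Fin n) (Fin p) ℝ) (y : Fin n → ℝ) (lam mu : ℝ)
    (T : Fin m → Finset (Fin p)) (a : Point p) : EReal :=
  ((linPart X y mu a : ℝ) : EReal) + phi (gram X lam) T a.z a.β

/-- The conditions on the additional SDP variables `(w, B)` for given `(z, β)`. -/
structure IsLift {p m : ℕ} (T : Fin m → Finset (Fin p)) (z β : Fin p → ℝ)
    (w : Fin m → ℝ) (B : Matrix (Fin p) (Fin p) ℝ) : Prop where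
  w_mem : ∀ h, w h ∈ Set.Icc (0 : ℝ) 1
  w_le : ∀ h, w h ≤ ∑ i ∈ T h, z i
  psd_sub : ∀ h, ((w h • B - Matrix.vecMulVec β β).submatrix
    (Subtype.val : {i // i ∈ T h} → Fin p) (Subtype.val : {i // i ∈ T h} → Fin p)).PosSemidef
  psd : (B - Matrix.vecMulVec β β).PosSemidef

/-- The inner product `⟨Q, B⟩ = tr (QᵀB)` of matrices. -/
def matInner {p : ℕ} (Q B : Matrix (Fin p) (Fin p) ℝ) : ℝ := (Qᵀ * B).trace

/-- The variables `(β, z, u, w, B)` of the SDP. -/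
structure SdpPoint (p m : ℕ) extends Point p where
  w : Fin m → ℝ
  B : Matrix (Fin p) (Fin p) ℝ

/-- The constraints of the SDP. -/
structure SdpFeasible {p m : ℕ} (k : ℕ) (T : Fin m → Finset (Fin p)) (s : SdpPoint p m) :
    Prop where
  base : Feasible k s.toPoint
  lift : IsLift T s.z s.β s.w s.B

/-- The objective `yᵀy - 2 yᵀXβ + μ eᵀu + ⟨XᵀX + λ I, B⟩` of the SDP. -/
def sdpObj {n p m : ℕ} (X : Matrix (Fin n) (Fin p) ℝ) (y : Fin n → ℝ) (lam mu : ℝ)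
    (s : SdpPoint p m) : ℝ :=
  linPart X y mu s.toPoint + matInner (gram X lam) s.B

/-- `a` is an optimal solution of the relaxation. -/
def RelaxOptimal {n p m : ℕ} (X : Matrix (Fin n) (Fin p) ℝ) (y : Fin n → ℝ) (lam mu : ℝ) (k : ℕ)
    (T : Fin m → Finset (Fin p)) (a : Point p) : Prop :=
  Feasible k a ∧ ∀ b, Feasible k b → relaxObj X y lam mu T a ≤ relaxObj X y lam mu T b

/-- `s` is an optimal solution of the SDP. -/
def SdpOptimal {n p m : ℕ} (X : Matrix (Fin n) (Fin p) ℝ) (y : Fin n → ℝ) (lam mu : ℝ) (k : ℕ)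
    (T : Fin m → Finset (Fin p)) (s : SdpPoint p m) : Prop :=
  SdpFeasible k T s ∧ ∀ t, SdpFeasible k T t → sdpObj X y lam mu s ≤ sdpObj X y lam mu t

end SparseReg

end

/-!
The relaxation and the SDP are linked by duality for fixed `(z, β)`. Write `t h = min {1, z (T h)}`
and `Q = XᵀX + λ I`.

Weak duality (`decompValue_le_matInner`): for a decomposition `Q = ∑ h, A h + R` and a lift `(w, B)`,
the inner product of `A h` with the positive semidefinite submatrix of `w h • B - ββᵀ` on `T h` gives
`βᵀ (A h) β ≤ w h * ⟨A h, B⟩` with `w h ≤ t h`, and `βᵀ R β ≤ ⟨R, B⟩`. Summation yields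
`φ(z, β) ≤ ⟨Q, B⟩`.

Strong duality (`exists_isLift_of_phi_lt`): suppose that `β` vanishes on `T h` whenever `t h = 0`.
The pairs `(∑ h, A h + R, βᵀ R β + ∑ h, βᵀ (A h) β / t h)` form a convex cone, which is closed because
the trace of the first component bounds all the matrices. If `φ(z, β) < L`, then `(Q, L)` lies outside
this cone, and a separating hyperplane provides `B` such that `(t, B)` is a lift and `⟨Q, B⟩ < L`.

The condition on `β` is harmless. If `Q` is positive definite, then `φ(z, β) = ∞` when it fails
(`phi_eq_top`). If `k ≥ 1`, then `z` can be mixed with a little of the constant vector `1 / p`, which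
makes all `t h` with `T h ≠ ∅` positive and increases `φ` by a factor close to `1` only
(`exists_isLift_of_phi_lt_of_one_le`). Hence the two problems have the same optimal value, and the
description of the optimal solutions follows. If `Q` is positive definite, then the minimum of
`⟨Q, B⟩` is attained by compactness (`exists_isLift_matInner_eq_phi`), so optimal solutions of the
relaxation lift.
-/

noncomputable section

namespace SparseReg

/-! ### Quadratic forms and inner products of matrices -/

section Matrices

variable {p : ℕ}

theorem quad_eq_sum (M : Matrix (Fin p) (Fin p) ℝ) (x : Fin p → ℝ) :
    quad M x = ∑ i, ∑ j, M i j * (x i * x j) := by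
  simp only [quad, dotProduct, Matrix.mulVec, Finset.mul_sum]
  exact Finset.sum_congr rfl fun i _ => Finset.sum_congr rfl fun j _ => by ring

theorem matInner_eq_sum (M N : Matrix (Fin p) (Fin p) ℝ) :
    matInner M N = ∑ i, ∑ j, M i j * N i j := by
  simp only [matInner, Matrix.trace, Matrix.diag, Matrix.mul_apply, Matrix.transpose_apply]
  exact Finset.sum_comm

theorem quad_eq_matInner (M : Matrix (Fin p) (Fin p) ℝ) (x : Fin p → ℝ) :
    quad M x = matInner M (Matrix.vecMulVec x x) := by
  simp [quad_eq_sum, matInner_eq_sum, Matrix.vecMulVec_apply]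

theorem matInner_add_left (M M' N : Matrix (Fin p) (Fin p) ℝ) :
    matInner (M + M') N = matInner M N + matInner M' N := by
  simp [matInner, Matrix.add_mul]

theorem matInner_sum_left {ι : Type*} (s : Finset ι) (M : ι → Matrix (Fin p) (Fin p) ℝ)
    (N : Matrix (Fin p) (Fin p) ℝ) :
    matInner (∑ i ∈ s, M i) N = ∑ i ∈ s, matInner (M i) N := by
  simp [matInner, Matrix.transpose_sum, Matrix.sum_mul, Matrix.trace_sum]

theorem matInner_sub_left (M M' N : Matrix (Fin p) (Fin p) ℝ) :
    matInner (M - M') N = matInner M N - matInner M' N := by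
  simp [matInner, Matrix.sub_mul]

theorem matInner_sub_right (M N N' : Matrix (Fin p) (Fin p) ℝ) :
    matInner M (N - N') = matInner M N - matInner M N' := by
  simp [matInner, Matrix.mul_sub]

theorem matInner_smul_right (M N : Matrix (Fin p) (Fin p) ℝ) (c : ℝ) :
    matInner M (c • N) = c * matInner M N := by
  simp [matInner]

theorem matInner_smul_one_left (N : Matrix (Fin p) (Fin p) ℝ) (c : ℝ) :
    matInner (c • 1) N = c * N.trace := by
  simp [matInner]

theorem matInner_comm (M N : Matrix (Fin p) (Fin p) ℝ) : matInner M N = matInner N M := by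
  simp only [matInner_eq_sum, mul_comm]

theorem quad_vecMulVec (v x : Fin p → ℝ) : quad (Matrix.vecMulVec v v) x = (v ⬝ᵥ x) ^ 2 := by
  simp only [quad_eq_sum, Matrix.vecMulVec_apply, sq, dotProduct, Finset.sum_mul_sum]
  exact Finset.sum_congr rfl fun i _ => Finset.sum_congr rfl fun j _ => by ring

theorem quad_add (M N : Matrix (Fin p) (Fin p) ℝ) (x : Fin p → ℝ) :
    quad (M + N) x = quad M x + quad N x := by
  simp [quad, Matrix.add_mulVec]

theorem quad_sub (M N : Matrix (Fin p) (Fin p) ℝ) (x : Fin p → ℝ) :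
    quad (M - N) x = quad M x - quad N x := by
  simp [quad, Matrix.sub_mulVec]

theorem quad_smul (c : ℝ) (M : Matrix (Fin p) (Fin p) ℝ) (x : Fin p → ℝ) :
    quad (c • M) x = c * quad M x := by
  simp [quad, Matrix.smul_mulVec]

theorem quad_smul_right (c : ℝ) (M : Matrix (Fin p) (Fin p) ℝ) (x : Fin p → ℝ) :
    quad M (c • x) = c ^ 2 * quad M x := by
  simp [quad, Matrix.mulVec_smul]; ring

/-- A quadratic form only depends on the coordinates of the support of its matrix. -/
theorem quad_eq_zero_of_support {A : Matrix (Fin p) (Fin p) ℝ} {S : Finset (Fin p)}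
    {x : Fin p → ℝ} (hA : ∀ i j, i ∉ S ∨ j ∉ S → A i j = 0) (hx : ∀ i ∈ S, x i = 0) :
    quad A x = 0 := by
  rw [quad_eq_sum]
  refine Finset.sum_eq_zero fun i _ => Finset.sum_eq_zero fun j _ => ?_
  by_cases hi : i ∈ S
  · simp [hx i hi]
  · simp [hA i j (Or.inl hi)]

/-! ### Positive semidefinite matrices -/

theorem posSemidef_iff_quad (M : Matrix (Fin p) (Fin p) ℝ) :
    M.PosSemidef ↔ (∀ i j, M i j = M j i) ∧ ∀ x, 0 ≤ quad M x := by
  rw [Matrix.posSemidef_iff_dotProduct_mulVec]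
  refine and_congr ⟨fun h i j => ?_, fun h => ?_⟩ (by simp [quad])
  · simpa using h.apply j i
  · ext i j
    simpa using h j i

theorem quad_nonneg {M : Matrix (Fin p) (Fin p) ℝ} (hM : M.PosSemidef) (x : Fin p → ℝ) :
    0 ≤ quad M x :=
  ((posSemidef_iff_quad M).1 hM).2 x

theorem posSemidef_vecMulVec (x : Fin p → ℝ) : (Matrix.vecMulVec x x).PosSemidef := by
  simpa using Matrix.posSemidef_vecMulVec_self_star x

theorem isClosed_posSemidef {ι : Type*} [Fintype ι] :
    IsClosed {M : Matrix ι ι ℝ | M.PosSemidef} := by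
  simp only [Matrix.posSemidef_iff_dotProduct_mulVec, Matrix.IsHermitian, dotProduct,
    Matrix.mulVec, Set.ofPred_and, Set.ofPred_forall]
  exact IsClosed.inter (isClosed_eq (by fun_prop) continuous_id)
    (isClosed_iInter fun x => isClosed_le continuous_const (by fun_prop))

open scoped MatrixOrder in
/-- The trace inner product of positive semidefinite matrices is nonnegative: with `A = Bᴴ B` it is
the trace of `B M Bᴴ`. -/
theorem trace_mul_nonneg {ι : Type*} [Fintype ι] {A M : Matrix ι ι ℝ}
    (hA : A.PosSemidef) (hM : M.PosSemidef) : 0 ≤ (A * M).trace := by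
  classical
  obtain ⟨B, rfl⟩ := CStarAlgebra.nonneg_iff_eq_star_mul_self.mp hA.nonneg
  rw [Matrix.trace_mul_cycle, Matrix.trace_mul_cycle]
  exact (hM.mul_mul_conjTranspose_same B).trace_nonneg

theorem matInner_nonneg {A M : Matrix (Fin p) (Fin p) ℝ}
    (hA : A.PosSemidef) (hM : M.PosSemidef) : 0 ≤ matInner A M :=
  trace_mul_nonneg hA.transpose hM

/-- The inner product with a matrix supported on `S × S` only sees the submatrix on `S`. -/
theorem matInner_nonneg_of_submatrix {A M : Matrix (Fin p) (Fin p) ℝ} {S : Finset (Fin p)}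
    (hA : A.PosSemidef) (hS : ∀ i j, i ∉ S ∨ j ∉ S → A i j = 0)
    (hM : (M.submatrix (Subtype.val : {i // i ∈ S} → Fin p)
      (Subtype.val : {i // i ∈ S} → Fin p)).PosSemidef) : 0 ≤ matInner A M := by
  have h := trace_mul_nonneg
    (hA.transpose.submatrix (Subtype.val : {i // i ∈ S} → Fin p)) hM
  have hsum : ∀ f : Fin p → ℝ, (∀ i, i ∉ S → f i = 0) → ∑ i, f i = ∑ i : {i // i ∈ S}, f i := by
    intro f hf
    rw [Finset.sum_coe_sort S f]
    exact (Finset.sum_subset (Finset.subset_univ S) fun i _ hi => hf i hi).symm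
  rw [matInner_eq_sum, Finset.sum_comm, hsum]
  · refine h.trans_eq ?_
    simp only [Matrix.trace, Matrix.diag, Matrix.mul_apply, Matrix.submatrix_apply,
      Matrix.transpose_apply]
    refine Finset.sum_congr rfl fun j _ => ?_
    rw [hsum]
    intro i hi
    simp [hS i j (Or.inl hi)]
  · intro j hj
    exact Finset.sum_eq_zero fun i _ => by simp [hS i j (Or.inr hj)]

/-- A principal submatrix is positive semidefinite as soon as the quadratic form is nonnegative on
the vectors supported on its index set. -/
theorem posSemidef_submatrix_of_quad {M : Matrix (Fin p) (Fin p) ℝ} {S : Finset (Fin p)}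
    (hM : ∀ i j, M i j = M j i)
    (h : ∀ x : Fin p → ℝ, (∀ i, i ∉ S → x i = 0) → 0 ≤ quad M x) :
    (M.submatrix (Subtype.val : {i // i ∈ S} → Fin p)
      (Subtype.val : {i // i ∈ S} → Fin p)).PosSemidef := by
  -- `N` is `M` with the entries outside `S × S` replaced by zero.
  let N : Matrix (Fin p) (Fin p) ℝ := Matrix.of fun i j => if i ∈ S ∧ j ∈ S then M i j else 0
  have hN : N.PosSemidef := by
    refine (posSemidef_iff_quad N).2 ⟨fun i j => ?_, fun x => ?_⟩
    · simp only [N, Matrix.of_apply, hM i j, and_comm]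
    · refine (h (fun i => if i ∈ S then x i else 0) fun i hi => by simp [hi]).trans_eq ?_
      rw [quad_eq_sum, quad_eq_sum]
      refine Finset.sum_congr rfl fun i _ => Finset.sum_congr rfl fun j _ => ?_
      by_cases hi : i ∈ S <;> by_cases hj : j ∈ S <;> simp [N, hi, hj]
  convert hN.submatrix (Subtype.val : {i // i ∈ S} → Fin p) using 1
  ext i j
  simp [N, i.2, j.2]

theorem abs_apply_le_trace {M : Matrix (Fin p) (Fin p) ℝ} (hM : M.PosSemidef) (i j : Fin p) :
    |M i j| ≤ M.trace := by
  have hd : ∀ a, 0 ≤ M a a := fun a => hM.diag_nonneg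
  have hsymm : M i j = M j i := ((posSemidef_iff_quad M).1 hM).1 i j
  rcases eq_or_ne i j with rfl | hij
  · rw [abs_of_nonneg (hd i)]
    exact Finset.single_le_sum (f := fun a => M a a) (fun a _ => hd a) (Finset.mem_univ i)
  · have htr : M i i + M j j ≤ M.trace := by
      rw [← Finset.sum_pair (f := fun a => M a a) hij]
      exact Finset.sum_le_sum_of_subset_of_nonneg (Finset.subset_univ _) fun a _ _ => hd a
    -- The form is evaluated at `eᵢ ± eⱼ`.
    have key : ∀ s : ℝ, quad M (Pi.single i 1 + Pi.single j s) =
        M i i + s * (M i j + M j i) + s ^ 2 * M j j := by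
      intro s
      simp [quad, Matrix.mulVec_add, add_dotProduct]
      ring
    have h1 := (key 1).symm ▸ quad_nonneg hM _
    have h2 := (key (-1)).symm ▸ quad_nonneg hM _
    have := hd i
    have := hd j
    rw [abs_le]
    constructor <;> linarith

/-- A positive definite matrix dominates a positive multiple of the identity, namely by the minimum
of its quadratic form on the unit sphere. -/
theorem exists_posSemidef_sub_smul_one {Q : Matrix (Fin p) (Fin p) ℝ} (hQ : Q.PosDef) :
    ∃ δ : ℝ, 0 < δ ∧ (Q - δ • (1 : Matrix (Fin p) (Fin p) ℝ)).PosSemidef := by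
  have hsymm := ((posSemidef_iff_quad Q).1 hQ.posSemidef).1
  have hc : Continuous fun x => quad Q x := by
    simp only [quad_eq_sum]
    fun_prop
  have hpos : ∀ x, x ≠ 0 → 0 < quad Q x := fun x hx => by
    simpa [quad] using hQ.dotProduct_mulVec_pos hx
  suffices h : ∃ δ : ℝ, 0 < δ ∧ ∀ x ∈ Metric.sphere (0 : Fin p → ℝ) 1, δ * (x ⬝ᵥ x) ≤ quad Q x by
    obtain ⟨δ, hδ, h⟩ := h
    refine ⟨δ, hδ, (posSemidef_iff_quad _).2 ⟨fun i j => ?_, fun x => ?_⟩⟩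
    · simp [hsymm i j, Matrix.one_apply, eq_comm]
    · have h1 : quad (1 : Matrix (Fin p) (Fin p) ℝ) x = x ⬝ᵥ x := by simp [quad]
      rw [quad_sub, quad_smul, h1, sub_nonneg]
      rcases eq_or_ne x 0 with rfl | hx
      · simp [quad]
      have hn : 0 < ‖x‖ := norm_pos_iff.2 hx
      have := h (‖x‖⁻¹ • x) (by simp [norm_smul, hn.ne'])
      rw [quad_smul_right, smul_dotProduct, dotProduct_smul, smul_eq_mul, smul_eq_mul] at this
      have h2 : 0 < (‖x‖⁻¹) ^ 2 := by positivity
      refine le_of_mul_le_mul_left ?_ h2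
      linarith
  rcases (Metric.sphere (0 : Fin p → ℝ) 1).eq_empty_or_nonempty with he | hne
  · exact ⟨1, one_pos, by simp [he]⟩
  · have hcd : Continuous fun x : Fin p → ℝ => x ⬝ᵥ x := by
      simp only [dotProduct]
      fun_prop
    obtain ⟨a, ha, hmin⟩ := (isCompact_sphere (0 : Fin p → ℝ) 1).exists_isMinOn hne hc.continuousOn
    obtain ⟨b, hb, hmax⟩ :=
      (isCompact_sphere (0 : Fin p → ℝ) 1).exists_isMaxOn hne hcd.continuousOn
    have hne0 : ∀ x ∈ Metric.sphere (0 : Fin p → ℝ) 1, x ≠ 0 := by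
      rintro x hx rfl
      simp at hx
    have hbb : 0 < b ⬝ᵥ b := by
      simpa using Matrix.dotProduct_star_self_pos_iff.2 (hne0 b hb)
    refine ⟨quad Q a / (b ⬝ᵥ b), div_pos (hpos a (hne0 a ha)) hbb, fun x hx => ?_⟩
    calc quad Q a / (b ⬝ᵥ b) * (x ⬝ᵥ x) ≤ quad Q a / (b ⬝ᵥ b) * (b ⬝ᵥ b) :=
          mul_le_mul_of_nonneg_left (hmax hx) (div_pos (hpos a (hne0 a ha)) hbb).le
      _ = quad Q a := div_mul_cancel₀ _ hbb.ne'
      _ ≤ quad Q x := hmin hx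

end Matrices

/-! ### Conic duality for decompositions -/

section ConicDuality

variable {p : ℕ} {ι : Type*}

/-- The closed convex cone of families of positive semidefinite matrices whose `i`-th member
vanishes outside `S i × S i`. -/
def supportedFamilies (S : ι → Finset (Fin p)) : Set (ι → Matrix (Fin p) (Fin p) ℝ) :=
  {A | ∀ i, (A i).PosSemidef ∧ ∀ a b, a ∉ S i ∨ b ∉ S i → A i a b = 0}

theorem isClosed_supportedFamilies (S : ι → Finset (Fin p)) :
    IsClosed (supportedFamilies S) := by
  have hpsd : ∀ i, IsClosed {A : ι → Matrix (Fin p) (Fin p) ℝ | (A i).PosSemidef} := fun i => by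
    have hi : Continuous fun A : ι → Matrix (Fin p) (Fin p) ℝ => A i := by fun_prop
    exact isClosed_posSemidef.preimage hi
  simp only [supportedFamilies, Set.ofPred_forall, Set.ofPred_and]
  refine isClosed_iInter fun i => (hpsd i).inter ?_
  exact isClosed_iInter fun a => isClosed_iInter fun b => isClosed_iInter fun _ =>
    isClosed_eq (by fun_prop) (by fun_prop)

theorem single_mem_supportedFamilies [DecidableEq ι] {S : ι → Finset (Fin p)} {i : ι}
    {M : Matrix (Fin p) (Fin p) ℝ} (hM : M.PosSemidef)
    (hS : ∀ a b, a ∉ S i ∨ b ∉ S i → M a b = 0) : Pi.single i M ∈ supportedFamilies S := by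
  intro j
  rcases eq_or_ne j i with rfl | hj
  · simpa using ⟨hM, hS⟩
  · simp [hj, Matrix.PosSemidef.zero]

variable [Fintype ι]

/-- The sum of a family of matrices, paired with the weighted sum of the values of their quadratic
forms at `β`. The matrix is a function of two arguments, so that the pair lies in a normed space. -/
def sumValue (c : ι → ℝ) (β : Fin p → ℝ) (A : ι → Matrix (Fin p) (Fin p) ℝ) :
    (Fin p → Fin p → ℝ) × ℝ :=
  (fun a b => ∑ i, A i a b, ∑ i, c i * quad (A i) β)

theorem continuous_sumValue (c : ι → ℝ) (β : Fin p → ℝ) :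
    Continuous (sumValue c β : (ι → Matrix (Fin p) (Fin p) ℝ) → _) := by
  unfold sumValue
  simp only [quad_eq_sum]
  fun_prop

/-- The trace of a sum of positive semidefinite matrices bounds all the entries of the summands, so
preimages under `sumValue` of convergent sequences have convergent subsequences. -/
theorem isClosed_image_sumValue (S : ι → Finset (Fin p)) (c : ι → ℝ) (β : Fin p → ℝ) :
    IsClosed (sumValue c β '' supportedFamilies S) := by
  refine IsSeqClosed.isClosed fun x x₀ hx hlim => ?_
  choose A hA hAx using hx
  have htr : Filter.Tendsto (fun n => ∑ a, (x n).1 a a) Filter.atTop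
      (nhds (∑ a, x₀.1 a a)) := by
    have hc : Continuous fun x : (Fin p → Fin p → ℝ) × ℝ => ∑ a, x.1 a a := by fun_prop
    exact (hc.tendsto x₀).comp hlim
  obtain ⟨C, hC⟩ := htr.bddAbove_range
  have hbound : ∀ n i a b, |A n i a b| ≤ C := by
    intro n i a b
    refine (abs_apply_le_trace (hA n i).1 a b).trans (le_trans ?_ (hC ⟨n, rfl⟩))
    have hsum : ∑ a, (x n).1 a a = ∑ i, (A n i).trace := by
      rw [← hAx n]
      exact Finset.sum_comm
    change (A n i).trace ≤ ∑ a, (x n).1 a a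
    rw [hsum]
    exact Finset.single_le_sum (f := fun i => (A n i).trace)
      (fun i _ => (hA n i).1.trace_nonneg) (Finset.mem_univ i)
  have hcpt : IsCompact (Set.Icc (fun _ _ _ => -C) (fun _ _ _ => C) :
      Set (ι → Fin p → Fin p → ℝ)) := isCompact_Icc
  obtain ⟨A₀, -, φ, hφ, hA₀⟩ := hcpt.tendsto_subseq (x := fun n i a b => A n i a b) fun n =>
    ⟨fun i a b => (abs_le.1 (hbound n i a b)).1, fun i a b => (abs_le.1 (hbound n i a b)).2⟩
  refine ⟨A₀, (isClosed_supportedFamilies S).mem_of_tendsto hA₀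
    (Filter.Eventually.of_forall fun n => hA (φ n)), ?_⟩
  refine tendsto_nhds_unique (((continuous_sumValue c β).tendsto A₀).comp hA₀) ?_
  refine (hlim.comp hφ.tendsto_atTop).congr fun n => ?_
  exact (hAx (φ n)).symm

/-- The closed convex cone of the pairs `(∑ i, A i, ∑ i, c i * quad (A i) β)`, for supported
families `A`. -/
def valueCone (S : ι → Finset (Fin p)) (c : ι → ℝ) (β : Fin p → ℝ) :
    ProperCone ℝ ((Fin p → Fin p → ℝ) × ℝ) where
  carrier := sumValue c β '' supportedFamilies S
  zero_mem' := ⟨0, fun i => ⟨Matrix.PosSemidef.zero, fun _ _ _ => rfl⟩, by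
    ext <;> simp [sumValue, quad]⟩
  add_mem' := by
    rintro _ _ ⟨A, hA, rfl⟩ ⟨A', hA', rfl⟩
    refine ⟨A + A', fun i => ⟨(hA i).1.add (hA' i).1, fun a b h => ?_⟩, ?_⟩
    · simp [(hA i).2 a b h, (hA' i).2 a b h]
    · ext <;> simp [sumValue, quad_add, mul_add, Finset.sum_add_distrib]
  smul_mem' := by
    rintro ⟨r, hr⟩ _ ⟨A, hA, rfl⟩
    refine ⟨r • A, fun i => ⟨(hA i).1.smul hr, fun a b h => ?_⟩, ?_⟩
    · simp [(hA i).2 a b h]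
    · change sumValue c β (r • A) = r • sumValue c β A
      ext <;> simp [sumValue, Finset.mul_sum, quad_smul, mul_left_comm]
  isClosed' := isClosed_image_sumValue S c β

/-- A continuous functional on pairs of a matrix and a number is a trace inner product plus a
multiple of the number. -/
theorem exists_matrix_of_functional (f : StrongDual ℝ ((Fin p → Fin p → ℝ) × ℝ)) :
    ∃ (C : Matrix (Fin p) (Fin p) ℝ) (t : ℝ), ∀ (M : Matrix (Fin p) (Fin p) ℝ) (s : ℝ),
      f (fun a b => M a b, s) = matInner M C + t * s := by
  refine ⟨Matrix.of fun a b => f (Pi.single a (Pi.single b 1), 0), f (0, 1), fun M s => ?_⟩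
  have h : ((fun a b => M a b, s) : (Fin p → Fin p → ℝ) × ℝ) = ∑ a, ∑ b, M a b •
      ((Pi.single a (Pi.single b 1), 0) : (Fin p → Fin p → ℝ) × ℝ) + s • (0, 1) := by
    ext a b
    · simp [Finset.sum_apply, Prod.fst_sum, Pi.single_apply]
    · simp [Prod.snd_sum]
  rw [h, matInner_eq_sum]
  simp only [map_add, map_sum, map_smul, smul_eq_mul, Matrix.of_apply]
  rw [mul_comm s]

/-- Strong duality: if every decomposition of `Q` along `S` has value less than `L`, then the dual
constraints have a solution `B` with `⟨Q, B⟩ < L`. The point `(Q, L)` lies outside `valueCone S c β`,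
and the normal vector of a separating hyperplane yields `B`; the hyperplane is not vertical because
the decomposition of `Q` with the single summand `Q` is available. -/
theorem exists_dual_of_forall_value_lt {Q : Matrix (Fin p) (Fin p) ℝ} (hQ : Q.PosSemidef)
    {S : ι → Finset (Fin p)} {c : ι → ℝ} {β : Fin p → ℝ} {L : ℝ} {i₀ : ι}
    (hi₀ : S i₀ = Finset.univ)
    (h : ∀ A ∈ supportedFamilies S, ∑ i, A i = Q → ∑ i, c i * quad (A i) β < L) :
    ∃ B : Matrix (Fin p) (Fin p) ℝ, (∀ a b, B a b = B b a) ∧ matInner Q B < L ∧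
      ∀ i v, (∀ a, a ∉ S i → v a = 0) → c i * (v ⬝ᵥ β) ^ 2 ≤ quad B v := by
  classical
  have hmem : ((fun a b => Q a b, L) : (Fin p → Fin p → ℝ) × ℝ) ∉ valueCone S c β := by
    rintro ⟨A, hA, hAQ⟩
    refine (h A hA ?_).ne (congrArg Prod.snd hAQ)
    ext a b
    rw [Matrix.sum_apply]
    exact congrFun (congrFun (congrArg Prod.fst hAQ) a) b
  obtain ⟨f, hf, hfQ⟩ := (valueCone S c β).hyperplane_separation_point hmem
  obtain ⟨C, t, hC⟩ := exists_matrix_of_functional f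
  rw [hC] at hfQ
  have hsingle : ∀ i (M : Matrix (Fin p) (Fin p) ℝ), M.PosSemidef →
      (∀ a b, a ∉ S i ∨ b ∉ S i → M a b = 0) → 0 ≤ matInner M C + t * (c i * quad M β) := by
    intro i M hM hMS
    rw [← hC]
    refine hf _ ⟨Pi.single i M, single_mem_supportedFamilies hM hMS, ?_⟩
    have hq : ∀ j, c j * quad ((Pi.single i M : ι → Matrix (Fin p) (Fin p) ℝ) j) β =
        if j = i then c i * quad M β else 0 := by
      intro j
      rcases eq_or_ne j i with rfl | hj
      · simp
      · simp [hj, quad]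
    ext a b
    · change ∑ j, (Pi.single i M : ι → Matrix (Fin p) (Fin p) ℝ) j a b = M a b
      rw [← Matrix.sum_apply, Finset.sum_pi_single']
      simp
    · simp [sumValue, hq]
  have hval : c i₀ * quad Q β < L := by
    have hmemQ : Pi.single i₀ Q ∈ supportedFamilies S :=
      single_mem_supportedFamilies hQ (by simp [hi₀])
    have := h _ hmemQ (by rw [Finset.sum_pi_single']; simp)
    rw [Finset.sum_eq_single i₀ (fun j _ hj => by simp [hj, quad]) (by simp)] at this
    simpa using this
  have ht : t < 0 := by
    have := hsingle i₀ Q hQ (by simp [hi₀])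
    by_contra! hge
    have := mul_le_mul_of_nonneg_left hval.le hge
    linarith
  have hcomm : ∀ M : Matrix (Fin p) (Fin p) ℝ, (∀ a b, M a b = M b a) →
      matInner M ((2 * -t)⁻¹ • (C + Cᵀ)) = (-t)⁻¹ * matInner M C := by
    intro M hM
    have h1 : matInner M Cᵀ = matInner M C := by
      rw [matInner_eq_sum, matInner_eq_sum, Finset.sum_comm]
      exact Finset.sum_congr rfl fun a _ => Finset.sum_congr rfl fun b _ => by
        rw [hM b a, Matrix.transpose_apply]
    rw [matInner_smul_right, matInner_comm, matInner_add_left, matInner_comm C, matInner_comm Cᵀ,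
      h1, mul_inv]
    ring
  refine ⟨(2 * -t)⁻¹ • (C + Cᵀ), fun a b => ?_, ?_, fun i v hv => ?_⟩
  · simp [add_comm]
  · rw [hcomm Q ((posSemidef_iff_quad Q).1 hQ).1, inv_mul_lt_iff₀ (neg_pos.2 ht)]
    linarith
  · have hs := hsingle i (Matrix.vecMulVec v v) (posSemidef_vecMulVec v) (by
      rintro a b (ha | hb)
      · simp [Matrix.vecMulVec_apply, hv a ha]
      · simp [Matrix.vecMulVec_apply, hv b hb])
    rw [quad_eq_matInner, matInner_comm, hcomm _ (fun a b => by
      simp [Matrix.vecMulVec_apply, mul_comm]), le_inv_mul_iff₀ (neg_pos.2 ht)]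
    rw [quad_vecMulVec] at hs
    linarith

end ConicDuality

/-! ### Values of decompositions -/

section Duality

variable {p m : ℕ} {Q : Matrix (Fin p) (Fin p) ℝ} {T : Fin m → Finset (Fin p)}
  {z β : Fin p → ℝ}

theorem ereal_coe_sum {ι : Type*} (s : Finset ι) (f : ι → ℝ) :
    ((∑ i ∈ s, f i : ℝ) : EReal) = ∑ i ∈ s, (f i : EReal) := by
  classical
  induction s using Finset.induction_on with
  | empty => simp
  | insert a s ha ih => rw [Finset.sum_insert ha, Finset.sum_insert ha, EReal.coe_add, ih]

theorem extDiv_eq_coe {s t : ℝ} (h : t = 0 → s = 0) : extDiv s t = ((s / t : ℝ) : EReal) := by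
  by_cases ht : t = 0
  · simp [extDiv, ht, h ht]
  · simp [extDiv, ht]

theorem extDiv_nonneg {s t : ℝ} (hs : 0 ≤ s) (ht : 0 ≤ t) : 0 ≤ extDiv s t := by
  unfold extDiv
  split_ifs
  · exact le_rfl
  · exact le_top
  · exact EReal.coe_nonneg.2 (div_nonneg hs ht)

theorem IsDecomp.quad_nonneg {A : Fin m → Matrix (Fin p) (Fin p) ℝ}
    {R : Matrix (Fin p) (Fin p) ℝ} (hA : IsDecomp Q T A R) (h : Fin m) (x : Fin p → ℝ) :
    0 ≤ quad (A h) x :=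
  SparseReg.quad_nonneg (hA.psd h) x

theorem min_one_sum_nonneg {S : Finset (Fin p)} (hz : ∀ i, 0 ≤ z i) :
    0 ≤ min 1 (∑ i ∈ S, z i) :=
  le_min zero_le_one (Finset.sum_nonneg fun i _ => hz i)

theorem min_one_eq_zero_iff {s : ℝ} : min 1 s = 0 ↔ s = 0 := by
  constructor
  · intro h
    rcases min_choice 1 s with h' | h' <;> rw [h'] at h
    · norm_num at h
    · exact h
  · rintro rfl
    simp

/-- If all the terms are finite, then the value of a decomposition is a real number. The real
division may be used throughout, since `0 / 0 = 0` also for real numbers. -/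
theorem decompValue_eq_coe {A : Fin m → Matrix (Fin p) (Fin p) ℝ}
    {R : Matrix (Fin p) (Fin p) ℝ}
    (h : ∀ h, min 1 (∑ i ∈ T h, z i) = 0 → quad (A h) β = 0) :
    decompValue T z β A R =
      ((quad R β + ∑ h, quad (A h) β / min 1 (∑ i ∈ T h, z i) : ℝ) : EReal) := by
  rw [decompValue, EReal.coe_add, ereal_coe_sum]
  exact congrArg _ (Finset.sum_congr rfl fun i _ => extDiv_eq_coe (h i))

theorem decompValue_eq_top {A : Fin m → Matrix (Fin p) (Fin p) ℝ}
    {R : Matrix (Fin p) (Fin p) ℝ} (hz : ∀ i, 0 ≤ z i) (hA : IsDecomp Q T A R) {h : Fin m}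
    (ht : min 1 (∑ i ∈ T h, z i) = 0) (hq : quad (A h) β ≠ 0) :
    decompValue T z β A R = ⊤ := by
  have hle : (⊤ : EReal) ≤ ∑ h, extDiv (quad (A h) β) (min 1 (∑ i ∈ T h, z i)) := by
    refine le_trans (le_of_eq ?_) (Finset.single_le_sum
      (f := fun h => extDiv (quad (A h) β) (min 1 (∑ i ∈ T h, z i)))
      (fun i _ => extDiv_nonneg (hA.quad_nonneg i β) (min_one_sum_nonneg hz)) (Finset.mem_univ h))
    simp [extDiv, ht, hq]
  rw [decompValue, top_le_iff.1 hle, EReal.add_top_of_ne_bot (EReal.coe_ne_bot _)]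

theorem decompValue_le_phi {A : Fin m → Matrix (Fin p) (Fin p) ℝ}
    {R : Matrix (Fin p) (Fin p) ℝ} (hA : IsDecomp Q T A R) :
    decompValue T z β A R ≤ phi Q T z β :=
  le_iSup_of_le A (le_iSup_of_le R (le_iSup_of_le hA le_rfl))

/-- The trivial decomposition shows that `φ` is at least the quadratic form of `Q`. -/
theorem quad_le_phi (hQ : Q.PosSemidef) : ((quad Q β : ℝ) : EReal) ≤ phi Q T z β := by
  have hA : IsDecomp Q T (fun _ => 0) Q :=
    ⟨by simp, fun _ _ _ _ => rfl, fun _ => Matrix.PosSemidef.zero, hQ⟩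
  refine le_trans (le_of_eq ?_) (decompValue_le_phi hA)
  rw [decompValue_eq_coe fun _ _ => by simp [quad]]
  simp [quad]

/-! ### Weak and strong duality for `φ` -/

/-- Each summand of a decomposition is bounded by its inner product with `B`. -/
theorem decompValue_le_matInner {A : Fin m → Matrix (Fin p) (Fin p) ℝ}
    {R B : Matrix (Fin p) (Fin p) ℝ} {w : Fin m → ℝ} (hA : IsDecomp Q T A R)
    (hB : IsLift T z β w B) : decompValue T z β A R ≤ ((matInner Q B : ℝ) : EReal) := by
  have hsub : ∀ h, quad (A h) β ≤ w h * matInner (A h) B := by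
    intro h
    have := matInner_nonneg_of_submatrix (hA.psd h) (hA.support h) (hB.psd_sub h)
    rw [matInner_sub_right, matInner_smul_right, ← quad_eq_matInner] at this
    linarith
  have hall : ∀ M : Matrix (Fin p) (Fin p) ℝ, M.PosSemidef → quad M β ≤ matInner M B := by
    intro M hM
    have := matInner_nonneg hM hB.psd
    rw [matInner_sub_right, ← quad_eq_matInner] at this
    linarith
  have hwt : ∀ h, w h ≤ min 1 (∑ i ∈ T h, z i) := fun h => le_min (hB.w_mem h).2 (hB.w_le h)
  have hmi : ∀ h, 0 ≤ matInner (A h) B := fun h =>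
    (hA.quad_nonneg h β).trans (hall _ (hA.psd h))
  rw [decompValue_eq_coe, EReal.coe_le_coe_iff, ← hA.sum_eq, matInner_add_left, matInner_sum_left,
    add_comm]
  · refine add_le_add (Finset.sum_le_sum fun h _ => ?_) (hall R hA.psd_rem)
    rcases ((hB.w_mem h).1.trans (hwt h)).eq_or_lt with ht | ht
    · simp [← ht, hmi h]
    · rw [div_le_iff₀ ht, mul_comm]
      exact (hsub h).trans (mul_le_mul_of_nonneg_right (hwt h) (hmi h))
  · intro h ht
    have hw : w h = 0 := le_antisymm (ht ▸ hwt h) (hB.w_mem h).1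
    have := hsub h
    rw [hw, zero_mul] at this
    exact le_antisymm this (hA.quad_nonneg h β)

theorem phi_le_matInner {B : Matrix (Fin p) (Fin p) ℝ} {w : Fin m → ℝ} (hB : IsLift T z β w B) :
    phi Q T z β ≤ ((matInner Q B : ℝ) : EReal) :=
  iSup_le fun _ => iSup_le fun _ => iSup_le fun hA => decompValue_le_matInner hA hB

/-- Strong duality. Conic duality is applied to the family `A` together with the remainder `R`,
which is indexed by `none` and carries no support condition. -/
theorem exists_isLift_of_phi_lt (hQ : Q.PosSemidef) (hz : ∀ i, 0 ≤ z i)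
    (hβ : ∀ h, ∑ i ∈ T h, z i = 0 → ∀ i ∈ T h, β i = 0) {L : ℝ}
    (hL : phi Q T z β < (L : EReal)) :
    ∃ B, IsLift T z β (fun h => min 1 (∑ i ∈ T h, z i)) B ∧ matInner Q B < L := by
  set t : Fin m → ℝ := fun h => min 1 (∑ i ∈ T h, z i) with ht
  have ht0 : ∀ h, 0 ≤ t h := fun h => min_one_sum_nonneg hz
  have hβt : ∀ h, t h = 0 → ∀ i ∈ T h, β i = 0 := fun h h0 =>
    hβ h (min_one_eq_zero_iff.1 h0)
  let S : Option (Fin m) → Finset (Fin p) := fun o => o.elim Finset.univ T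
  -- The inverse of `t h` is `0` for `t h = 0`, which makes the corresponding constraint void.
  let c : Option (Fin m) → ℝ := fun o => o.elim 1 fun h => (t h)⁻¹
  obtain ⟨B, hsymm, hBL, hB⟩ := exists_dual_of_forall_value_lt (S := S) (c := c) (β := β)
    (L := L) (i₀ := none) hQ rfl (by
      intro A hA hsum
      have hdec : IsDecomp Q T (fun h => A (some h)) (A none) := by
        refine ⟨?_, fun h => (hA (some h)).2, fun h => (hA (some h)).1, (hA none).1⟩
        rw [← hsum, Fintype.sum_option, add_comm]
      have hlt := (decompValue_le_phi (z := z) (β := β) hdec).trans_lt hL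
      rw [decompValue_eq_coe fun h h0 =>
        quad_eq_zero_of_support (hA (some h)).2 (hβt h h0), EReal.coe_lt_coe_iff] at hlt
      rw [Fintype.sum_option]
      simpa [c, t, div_eq_inv_mul] using hlt)
  have hquad : ∀ r v, quad (r • B - Matrix.vecMulVec β β) v = r * quad B v - (v ⬝ᵥ β) ^ 2 := by
    intro r v
    rw [quad_sub, quad_smul, quad_vecMulVec, dotProduct_comm]
  refine ⟨B, ⟨fun h => ⟨ht0 h, min_le_left _ _⟩, fun h => min_le_right _ _, fun h => ?_, ?_⟩, hBL⟩
  · refine posSemidef_submatrix_of_quad (fun i j => ?_) fun v hv => ?_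
    · simp [hsymm i j, Matrix.vecMulVec_apply, mul_comm]
    · rw [hquad]
      rcases (ht0 h).eq_or_lt with h0 | h0
      · have hvβ : v ⬝ᵥ β = 0 := Finset.sum_eq_zero fun i _ => by
          by_cases hi : i ∈ T h
          · simp [hβt h h0.symm i hi]
          · simp [hv i hi]
        simp [hvβ, ← h0]
      · have := hB (some h) v hv
        change (t h)⁻¹ * (v ⬝ᵥ β) ^ 2 ≤ quad B v at this
        rw [inv_mul_le_iff₀ h0] at this
        linarith
  · refine (posSemidef_iff_quad _).2 ⟨fun i j => ?_, fun v => ?_⟩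
    · simp [hsymm i j, Matrix.vecMulVec_apply, mul_comm]
    · have := hB none v (by simp [S])
      change 1 * (v ⬝ᵥ β) ^ 2 ≤ quad B v at this
      have h1 := hquad 1 v
      rw [one_smul] at h1
      rw [h1]
      linarith

/-- For positive definite `Q`, a small multiple of the identity on `T h` can be split off from `Q`,
so that a nonzero `β` on a set with `z (T h) = 0` costs infinitely much. -/
theorem phi_eq_top (hQ : Q.PosDef) (hz : ∀ i, 0 ≤ z i) {h : Fin m}
    (hzero : ∑ i ∈ T h, z i = 0) {i : Fin p} (hi : i ∈ T h) (hβ : β i ≠ 0) :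
    phi Q T z β = ⊤ := by
  obtain ⟨δ, hδ, hpsd⟩ := exists_posSemidef_sub_smul_one hQ
  let D : Matrix (Fin p) (Fin p) ℝ := Matrix.diagonal fun a => if a ∈ T h then δ else 0
  have hD : D.PosSemidef := Matrix.PosSemidef.diagonal fun a => by
    dsimp only
    split_ifs <;> simp [hδ.le]
  have hR : (Q - D).PosSemidef := by
    have hD' : (Matrix.diagonal fun a => if a ∈ T h then 0 else δ :
        Matrix (Fin p) (Fin p) ℝ).PosSemidef := Matrix.PosSemidef.diagonal fun a => by
      dsimp only
      split_ifs <;> simp [hδ.le]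
    convert hpsd.add hD' using 1
    ext a b
    rcases eq_or_ne a b with rfl | hab
    · by_cases ha : a ∈ T h <;> simp [D, ha]
    · simp [D, hab]
  have hdec : IsDecomp Q T (Pi.single h D) (Q - D) := by
    refine ⟨?_, fun g a b hab => ?_, fun g => ?_, hR⟩
    · rw [Finset.sum_pi_single']
      simp
    · rcases eq_or_ne g h with rfl | hg
      · rcases eq_or_ne a b with rfl | hne
        · simp [D, (or_self_iff.1 hab)]
        · simp [D, hne]
      · simp [hg]
    · rcases eq_or_ne g h with rfl | hg
      · simpa using hD
      · simp [hg, Matrix.PosSemidef.zero]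
  have hq : quad ((Pi.single h D : Fin m → Matrix (Fin p) (Fin p) ℝ) h) β ≠ 0 := by
    have hval : quad D β = ∑ a, (if a ∈ T h then δ else 0) * (β a) ^ 2 := by
      simp only [quad, D, dotProduct, Matrix.mulVec_diagonal]
      exact Finset.sum_congr rfl fun a _ => by ring
    rw [Pi.single_eq_same, hval]
    refine (Finset.sum_pos' (fun a _ => ?_) ⟨i, Finset.mem_univ i, ?_⟩).ne'
    · split_ifs <;> positivity
    · rw [if_pos hi]
      positivity
  exact top_le_iff.1 ((decompValue_eq_top hz hdec (min_one_eq_zero_iff.2 hzero) hq).ge.trans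
    (decompValue_le_phi hdec))

/-- `φ(z, β)` is the optimal value of the minimization over the lifts. -/
theorem phi_eq_iInf_matInner (hQ : Q.PosSemidef) (hz : ∀ i, 0 ≤ z i)
    (h : Q.PosDef ∨ ∀ h, ∑ i ∈ T h, z i = 0 → ∀ i ∈ T h, β i = 0) :
    phi Q T z β = ⨅ (w : Fin m → ℝ) (B : Matrix (Fin p) (Fin p) ℝ) (_ : IsLift T z β w B),
      ((matInner Q B : ℝ) : EReal) := by
  refine le_antisymm (le_iInf fun w => le_iInf fun B => le_iInf fun hB => phi_le_matInner hB) ?_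
  by_cases hβ : ∀ h, ∑ i ∈ T h, z i = 0 → ∀ i ∈ T h, β i = 0
  · refine EReal.le_of_forall_lt_iff_le.1 fun L hL => ?_
    obtain ⟨B, hB, hBL⟩ := exists_isLift_of_phi_lt hQ hz hβ hL
    exact iInf_le_of_le _ (iInf_le_of_le B (iInf_le_of_le hB (EReal.coe_le_coe_iff.2 hBL.le)))
  · have hpd := h.resolve_right hβ
    push Not at hβ
    obtain ⟨h, hzero, i, hi, hne⟩ := hβ
    rw [phi_eq_top hpd hz hzero hi hne]
    exact le_top

/-- For positive definite `Q`, the sublevel sets of `⟨Q, ·⟩` on the positive semidefinite cone are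
compact, so the minimum over the lifts is attained when it is finite. -/
theorem exists_isLift_matInner_eq_phi (hQ : Q.PosDef) (hz : ∀ i, 0 ≤ z i)
    (hfin : phi Q T z β ≠ ⊤) :
    ∃ w B, IsLift T z β w B ∧ ((matInner Q B : ℝ) : EReal) = phi Q T z β := by
  have hβ : ∀ h, ∑ i ∈ T h, z i = 0 → ∀ i ∈ T h, β i = 0 := by
    intro h hzero i hi
    by_contra hne
    exact hfin (phi_eq_top hQ hz hzero hi hne)
  have hbot : phi Q T z β ≠ ⊥ :=
    ((EReal.bot_lt_coe _).trans_le (quad_le_phi hQ.posSemidef)).ne'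
  obtain ⟨c, hc⟩ : ∃ c : ℝ, phi Q T z β = c := ⟨_, (EReal.coe_toReal hfin hbot).symm⟩
  obtain ⟨δ, hδ, hpsd⟩ := exists_posSemidef_sub_smul_one hQ
  let t : Fin m → ℝ := fun h => min 1 (∑ i ∈ T h, z i)
  let K : Set (Matrix (Fin p) (Fin p) ℝ) := {B | IsLift T z β t B ∧ matInner Q B ≤ c + 1}
  have hcont : Continuous fun B : Matrix (Fin p) (Fin p) ℝ => matInner Q B := by
    simp only [matInner_eq_sum]
    fun_prop
  have hlow : ∀ L : ℝ, c < L → ∃ B, IsLift T z β t B ∧ matInner Q B < L := fun L hL =>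
    exists_isLift_of_phi_lt hQ.posSemidef hz hβ (by rw [hc]; exact EReal.coe_lt_coe_iff.2 hL)
  have hbound : ∀ B ∈ K, ∀ i j, |B i j| ≤ (c + 1) / δ := by
    rintro B ⟨hB, hBc⟩ i j
    have hBpsd : B.PosSemidef := by
      simpa using hB.psd.add (posSemidef_vecMulVec β)
    refine (abs_apply_le_trace hBpsd i j).trans ((le_div_iff₀ hδ).2 ?_)
    have := matInner_nonneg hpsd hBpsd
    rw [matInner_sub_left, matInner_smul_one_left] at this
    linarith
  have hclosed : IsClosed K := by
    have hset : K = (⋂ h, {B | ((t h • B - Matrix.vecMulVec β β).submatrix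
        (Subtype.val : {i // i ∈ T h} → Fin p)
        (Subtype.val : {i // i ∈ T h} → Fin p)).PosSemidef}) ∩
        ({B | (B - Matrix.vecMulVec β β).PosSemidef} ∩ {B | matInner Q B ≤ c + 1}) := by
      ext B
      simp only [K, Set.mem_inter_iff, Set.mem_iInter, Set.mem_ofPred_eq]
      refine ⟨fun ⟨hB, h⟩ => ⟨hB.psd_sub, hB.psd, h⟩, fun ⟨h1, h2, h3⟩ => ⟨⟨fun h => ?_, fun h => ?_,
        h1, h2⟩, h3⟩⟩
      · exact ⟨min_one_sum_nonneg hz, min_le_left _ _⟩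
      · exact min_le_right _ _
    have hsub : ∀ h, Continuous fun B : Matrix (Fin p) (Fin p) ℝ =>
        (t h • B - Matrix.vecMulVec β β).submatrix
          (Subtype.val : {i // i ∈ T h} → Fin p) (Subtype.val : {i // i ∈ T h} → Fin p) :=
      fun h => by fun_prop
    have hfull : Continuous fun B : Matrix (Fin p) (Fin p) ℝ => B - Matrix.vecMulVec β β := by
      fun_prop
    rw [hset]
    exact (isClosed_iInter fun h => isClosed_posSemidef.preimage (hsub h)).inter
      ((isClosed_posSemidef.preimage hfull).inter (isClosed_le hcont continuous_const))
  have hcpt : IsCompact K := by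
    refine (isCompact_Icc (a := (fun _ _ => -((c + 1) / δ) : Fin p → Fin p → ℝ))
      (b := fun _ _ => (c + 1) / δ)).of_isClosed_subset hclosed fun B hB => ?_
    exact ⟨fun i j => (abs_le.1 (hbound B hB i j)).1, fun i j => (abs_le.1 (hbound B hB i j)).2⟩
  have hne : K.Nonempty := by
    obtain ⟨B, hB, hBL⟩ := hlow (c + 1) (by linarith)
    exact ⟨B, hB, hBL.le⟩
  obtain ⟨B, hB, hmin⟩ := hcpt.exists_isMinOn hne hcont.continuousOn
  refine ⟨t, B, hB.1, le_antisymm ?_ (phi_le_matInner hB.1)⟩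
  rw [hc, EReal.coe_le_coe_iff]
  refine le_of_forall_gt_imp_ge_of_dense fun L hL => ?_
  obtain ⟨B', hB', hBL'⟩ := hlow (min L (c + 1)) (lt_min hL (by linarith))
  exact (hmin ⟨hB', (hBL'.trans_le (min_le_right _ _)).le⟩).trans
    (hBL'.trans_le (min_le_left _ _)).le

end Duality

/-! ### Approximation by points with no vanishing `z (T h)` -/

section Approximation

variable {p m : ℕ} {Q : Matrix (Fin p) (Fin p) ℝ} {T : Fin m → Finset (Fin p)}
  {z β : Fin p → ℝ}

/-- Shrinking all the denominators by at most the factor `r` increases `φ` at most by the factor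
`1 / r`. -/
theorem phi_le_div_of_mul_le {z' : Fin p → ℝ} {r c : ℝ} (hr : 0 < r) (hr1 : r ≤ 1)
    (hz : ∀ i, 0 ≤ z i) (hz' : ∀ i, r * z i ≤ z' i) (hc : phi Q T z β ≤ (c : EReal)) :
    phi Q T z' β ≤ ((c / r : ℝ) : EReal) := by
  refine iSup_le fun A => iSup_le fun R => iSup_le fun hA => ?_
  have hle := (decompValue_le_phi (z := z) (β := β) hA).trans hc
  have hfin : ∀ h, min 1 (∑ i ∈ T h, z i) = 0 → quad (A h) β = 0 := by
    intro h h0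
    by_contra hne
    rw [decompValue_eq_top hz hA h0 hne] at hle
    exact EReal.coe_ne_top c (top_le_iff.1 hle)
  have hmin : ∀ h, r * min 1 (∑ i ∈ T h, z i) ≤ min 1 (∑ i ∈ T h, z' i) := by
    intro h
    rw [mul_min_of_nonneg _ _ hr.le, mul_one, Finset.mul_sum]
    exact min_le_min hr1 (Finset.sum_le_sum fun i _ => hz' i)
  have ht : ∀ h, 0 ≤ min 1 (∑ i ∈ T h, z i) := fun h => min_one_sum_nonneg hz
  have hfin' : ∀ h, min 1 (∑ i ∈ T h, z' i) = 0 → quad (A h) β = 0 := by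
    intro h h0
    refine hfin h (le_antisymm ?_ (ht h))
    exact nonpos_of_mul_nonpos_right ((hmin h).trans_eq h0) hr
  rw [decompValue_eq_coe hfin, EReal.coe_le_coe_iff] at hle
  rw [decompValue_eq_coe hfin', EReal.coe_le_coe_iff, le_div_iff₀ hr, add_mul, Finset.sum_mul]
  refine le_trans (add_le_add ?_ (Finset.sum_le_sum fun h _ => ?_)) hle
  · exact mul_le_of_le_one_right (quad_nonneg hA.psd_rem β) hr1
  · rcases (ht h).eq_or_lt with h0 | h0
    · simp [hfin h h0.symm]
    · have hpos : 0 < min 1 (∑ i ∈ T h, z' i) := (mul_pos hr h0).trans_le (hmin h)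
      rw [div_mul_eq_mul_div, div_le_div_iff₀ hpos h0, mul_assoc]
      exact mul_le_mul_of_nonneg_left (hmin h) (hA.quad_nonneg h β)

/-- Mixing `z` with the vector `(1/p, …, 1/p)` makes every `z (T h)` with `T h ≠ ∅` positive; the
cardinality constraint survives for `1 ≤ k`. -/
theorem exists_isLift_of_phi_lt_of_one_le {k : ℕ} (hk : 1 ≤ k) (hQ : Q.PosSemidef)
    (hz : ∀ i, z i ∈ Set.Icc (0 : ℝ) 1) (hzk : ∑ i, z i ≤ k) {L : ℝ}
    (hL : phi Q T z β < (L : EReal)) :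
    ∃ (z' : Fin p → ℝ) (w : Fin m → ℝ) (B : Matrix (Fin p) (Fin p) ℝ),
      (∀ i, z' i ∈ Set.Icc (0 : ℝ) 1) ∧ ∑ i, z' i ≤ k ∧ IsLift T z' β w B ∧
      matInner Q B < L := by
  have hquad := quad_le_phi (T := T) (z := z) (β := β) hQ
  obtain ⟨c, hc⟩ : ∃ c : ℝ, phi Q T z β = c :=
    ⟨_, (EReal.coe_toReal hL.ne_top ((EReal.bot_lt_coe _).trans_le hquad).ne').symm⟩
  have hc0 : 0 ≤ c := by
    rw [hc, EReal.coe_le_coe_iff] at hquad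
    exact (quad_nonneg hQ β).trans hquad
  have hcL : c < L := by
    rwa [hc, EReal.coe_lt_coe_iff] at hL
  have hL0 : 0 < L := hc0.trans_lt hcL
  -- `r` lies in `(c / L, 1)`, so that `c / r < L`.
  let r : ℝ := (c + L) / (2 * L)
  have hr : 0 < r := by positivity
  have hr1 : r < 1 := by
    rw [div_lt_one (by positivity)]
    linarith
  have hcr : c / r < L := by
    rw [div_lt_iff₀ hr]
    have : L * r = (c + L) / 2 := by
      simp only [r]
      field_simp
    linarith
  have hfrac : ∀ _ : Fin p, 0 < (1 - r) / p ∧ (1 - r) / p ≤ 1 - r := by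
    intro i
    have hp : (1 : ℝ) ≤ p := by exact_mod_cast i.pos
    exact ⟨div_pos (by linarith) (by linarith), div_le_self (by linarith) hp⟩
  let z' : Fin p → ℝ := fun i => r * z i + (1 - r) / p
  have hz' : ∀ i, 0 < z' i := fun i =>
    add_pos_of_nonneg_of_pos (mul_nonneg hr.le (hz i).1) (hfrac i).1
  have hphi : phi Q T z' β < (L : EReal) :=
    (phi_le_div_of_mul_le hr hr1.le (fun i => (hz i).1)
      (fun i => le_add_of_nonneg_right (hfrac i).1.le) hc.le).trans_lt
      (EReal.coe_lt_coe_iff.2 hcr)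
  obtain ⟨B, hB, hBL⟩ := exists_isLift_of_phi_lt hQ (fun i => (hz' i).le) (fun h h0 i hi =>
    absurd h0 (Finset.sum_pos (fun j _ => hz' j) ⟨i, hi⟩).ne') hphi
  refine ⟨z', _, B, fun i => ⟨(hz' i).le, ?_⟩, ?_, hB, hBL⟩
  · have := mul_le_mul_of_nonneg_left (hz i).2 hr.le
    have := (hfrac i).2
    simp only [z']
    linarith
  · have hk1 : (1 : ℝ) ≤ k := by exact_mod_cast hk
    have hp : (p : ℝ) * ((1 - r) / p) ≤ 1 - r := by
      rcases eq_or_ne (p : ℝ) 0 with h0 | h0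
      · simpa [h0] using hr1.le
      · exact (mul_div_cancel₀ _ h0).le
    have := mul_le_mul_of_nonneg_left hzk hr.le
    have := mul_le_mul_of_nonneg_left hk1 (sub_nonneg.2 hr1.le)
    simp only [z', Finset.sum_add_distrib, ← Finset.mul_sum, Finset.sum_const, Finset.card_univ,
      Fintype.card_fin, nsmul_eq_mul]
    linarith

end Approximation

/-! ### Equivalence of the two problems -/

section Equivalence

variable {n p m : ℕ} {X : Matrix (Fin n) (Fin p) ℝ} {y : Fin n → ℝ} {lam mu : ℝ} {k : ℕ}
  {T : Fin m → Finset (Fin p)}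

theorem gram_posSemidef (X : Matrix (Fin n) (Fin p) ℝ) (hlam : 0 ≤ lam) :
    (gram X lam).PosSemidef := by
  have h := Matrix.posSemidef_conjTranspose_mul_self X
  rw [Matrix.conjTranspose_eq_transpose_of_trivial] at h
  exact h.add (Matrix.PosSemidef.one.smul hlam)

theorem relaxObj_le_sdpObj {s : SdpPoint p m} (hs : SdpFeasible k T s) :
    relaxObj X y lam mu T s.toPoint ≤ ((sdpObj X y lam mu s : ℝ) : EReal) := by
  rw [relaxObj, sdpObj, EReal.coe_add]
  gcongr
  exact phi_le_matInner hs.lift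

theorem relaxObj_eq_coe_add_iff {a : Point p} {c : ℝ} :
    relaxObj X y lam mu T a = ((linPart X y mu a + c : ℝ) : EReal) ↔
      (c : EReal) = phi (gram X lam) T a.z a.β := by
  rw [relaxObj, EReal.coe_add]
  refine ⟨fun h => ?_, fun h => by rw [h]⟩
  generalize phi (gram X lam) T a.z a.β = φ at h ⊢
  induction φ with
  | bot => exact absurd h (by simp [← EReal.coe_add])
  | coe x =>
    rw [← EReal.coe_add, ← EReal.coe_add, EReal.coe_eq_coe_iff] at h
    rw [add_left_cancel h]
  | top =>
    exact absurd h (by simp [EReal.add_top_of_ne_bot, ← EReal.coe_add])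

/-- Feasible points of the SDP come arbitrarily close to the objective value of a feasible point of
the relaxation, possibly after a perturbation of `z`. -/
theorem exists_sdpFeasible_sdpObj_lt (hlam : 0 ≤ lam) (hk : 1 ≤ k ∨ (gram X lam).PosDef)
    {a : Point p} (ha : Feasible k a) {L : ℝ} (hL : relaxObj X y lam mu T a < (L : EReal)) :
    ∃ s : SdpPoint p m, SdpFeasible k T s ∧ sdpObj X y lam mu s < L := by
  have hQ := gram_posSemidef X hlam
  have hphi : phi (gram X lam) T a.z a.β < ((L - linPart X y mu a : ℝ) : EReal) := by
    rw [relaxObj] at hL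
    generalize phi (gram X lam) T a.z a.β = φ at hL ⊢
    induction φ with
    | bot => exact EReal.bot_lt_coe _
    | coe x =>
      rw [← EReal.coe_add, EReal.coe_lt_coe_iff] at hL
      rw [EReal.coe_lt_coe_iff]
      linarith
    | top =>
      rw [EReal.add_top_of_ne_bot (EReal.coe_ne_bot _)] at hL
      exact absurd hL not_top_lt
  obtain ⟨z', w, B, hz', hzk, hB, hBL⟩ :
      ∃ (z' : Fin p → ℝ) (w : Fin m → ℝ) (B : Matrix (Fin p) (Fin p) ℝ),
      (∀ i, z' i ∈ Set.Icc (0 : ℝ) 1) ∧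
      ∑ i, z' i ≤ k ∧ IsLift T z' a.β w B ∧
      matInner (gram X lam) B < L - linPart X y mu a := by
    rcases hk with hk | hpd
    · exact exists_isLift_of_phi_lt_of_one_le hk hQ ha.z_mem ha.card hphi
    · obtain ⟨w, B, hB, hBeq⟩ :=
        exists_isLift_matInner_eq_phi hpd (fun i => (ha.z_mem i).1) hphi.ne_top
      exact ⟨a.z, w, B, ha.z_mem, ha.card, hB, EReal.coe_lt_coe_iff.1 (hBeq ▸ hphi)⟩
  refine ⟨⟨⟨a.β, z', a.u⟩, w, B⟩, ⟨⟨hzk, ha.le_u, ha.neg_le_u, hz', ha.u_nonneg⟩, hB⟩, ?_⟩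
  change linPart X y mu a + matInner (gram X lam) B < L
  linarith

/-- The origin is feasible with a finite objective value. -/
theorem exists_feasible_relaxObj_ne_top :
    ∃ a : Point p, Feasible k a ∧ relaxObj X y lam mu T a ≠ ⊤ := by
  have hs : SdpFeasible k T (⟨⟨0, 0, 0⟩, 0, 0⟩ : SdpPoint p m) := by
    refine ⟨⟨by simp, by simp, by simp, by simp, by simp⟩, ⟨by simp, by simp, fun h => ?_, ?_⟩⟩
    · simpa using Matrix.PosSemidef.zero
    · simpa using Matrix.PosSemidef.zero
  exact ⟨_, hs.base, ((relaxObj_le_sdpObj hs).trans_lt (EReal.coe_lt_top _)).ne⟩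

/-- An SDP solution whose objective value is attained by an optimal solution of the relaxation is
optimal, as the relaxation is a lower bound. -/
theorem sdpOptimal_of_relaxOptimal {s : SdpPoint p m} (hs : SdpFeasible k T s)
    (hopt : RelaxOptimal X y lam mu k T s.toPoint)
    (heq : ((matInner (gram X lam) s.B : ℝ) : EReal) = phi (gram X lam) T s.z s.β) :
    SdpOptimal X y lam mu k T s := by
  refine ⟨hs, fun t ht => EReal.coe_le_coe_iff.1 ?_⟩
  rw [sdpObj, ← relaxObj_eq_coe_add_iff.2 heq]
  exact (hopt.2 _ ht.base).trans (relaxObj_le_sdpObj ht)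

theorem sdpObj_le_relaxObj_of_sdpOptimal (hlam : 0 ≤ lam)
    (hk : 1 ≤ k ∨ (gram X lam).PosDef) {s : SdpPoint p m} (hs : SdpOptimal X y lam mu k T s)
    {a : Point p} (ha : Feasible k a) :
    ((sdpObj X y lam mu s : ℝ) : EReal) ≤ relaxObj X y lam mu T a := by
  refine EReal.le_of_forall_lt_iff_le.1 fun L hL => ?_
  obtain ⟨t, ht, htL⟩ := exists_sdpFeasible_sdpObj_lt hlam hk ha hL
  exact EReal.coe_le_coe_iff.2 ((hs.2 t ht).trans htL.le)

end Equivalence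

end SparseReg

end

theorem theorem3 {n p m : ℕ} (X : Matrix (Fin n) (Fin p) ℝ) (y : Fin n → ℝ) (lam mu : ℝ)
    (hlam : 0 ≤ lam) (hmu : 0 ≤ mu) (k : ℕ) (T : Fin m → Finset (Fin p))
    (hk : 1 ≤ k ∨ (SparseReg.gram X lam).PosDef) :
    -- the two problems have the same optimal value
    (⨅ (a : SparseReg.Point p) (_ : SparseReg.Feasible k a), SparseReg.relaxObj X y lam mu T a) =
      (⨅ (s : SparseReg.SdpPoint p m) (_ : SparseReg.SdpFeasible k T s),
        ((SparseReg.sdpObj X y lam mu s : ℝ) : EReal)) ∧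
    -- forgetting `(w, B)` maps SDP solutions to solutions of the relaxation that are no worse
    (∀ s : SparseReg.SdpPoint p m, SparseReg.SdpFeasible k T s →
      SparseReg.Feasible k s.toPoint ∧
      SparseReg.relaxObj X y lam mu T s.toPoint ≤ ((SparseReg.sdpObj X y lam mu s : ℝ) : EReal)) ∧
    -- for fixed `(z, β)`, optimizing over `(w, B)` gives `φ(z, β)`
    (∀ z β : Fin p → ℝ, (∀ i, z i ∈ Set.Icc (0 : ℝ) 1) →
      ((SparseReg.gram X lam).PosDef ∨
        ∀ h, ∑ i ∈ T h, z i = 0 → ∀ i ∈ T h, β i = 0) →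
      SparseReg.phi (SparseReg.gram X lam) T z β =
        ⨅ (w : Fin m → ℝ) (B : Matrix (Fin p) (Fin p) ℝ) (_ : SparseReg.IsLift T z β w B),
          ((SparseReg.matInner (SparseReg.gram X lam) B : ℝ) : EReal)) ∧
    -- optimal SDP solutions are the optimal solutions of the relaxation with `⟨Q, B⟩ = φ(z, β)`
    (∀ s : SparseReg.SdpPoint p m, SparseReg.SdpOptimal X y lam mu k T s ↔
      SparseReg.SdpFeasible k T s ∧ SparseReg.RelaxOptimal X y lam mu k T s.toPoint ∧
      ((SparseReg.matInner (SparseReg.gram X lam) s.B : ℝ) : EReal) =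
        SparseReg.phi (SparseReg.gram X lam) T s.z s.β) ∧
    -- if `XᵀX + λ I` is positive definite, every optimal solution of the relaxation lifts
    ((SparseReg.gram X lam).PosDef → ∀ a : SparseReg.Point p,
      SparseReg.RelaxOptimal X y lam mu k T a →
      ∃ (w : Fin m → ℝ) (B : Matrix (Fin p) (Fin p) ℝ),
        SparseReg.SdpOptimal X y lam mu k T ⟨a, w, B⟩) := by
  have hQ := SparseReg.gram_posSemidef X hlam
  refine ⟨le_antisymm ?_ ?_, fun s hs => ⟨hs.base, SparseReg.relaxObj_le_sdpObj hs⟩,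
    fun z β hz h => SparseReg.phi_eq_iInf_matInner hQ (fun i => (hz i).1) h,
    fun s => ⟨fun hs => ?_, fun hs => SparseReg.sdpOptimal_of_relaxOptimal hs.1 hs.2.1 hs.2.2⟩,
    fun hpd a ha => ?_⟩
  · exact le_iInf fun s => le_iInf fun hs =>
      iInf_le_of_le s.toPoint (iInf_le_of_le hs.base (SparseReg.relaxObj_le_sdpObj hs))
  · refine le_iInf fun a => le_iInf fun ha => EReal.le_of_forall_lt_iff_le.1 fun L hL => ?_
    obtain ⟨s, hs, hsL⟩ := SparseReg.exists_sdpFeasible_sdpObj_lt hlam hk ha hL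
    exact iInf_le_of_le s (iInf_le_of_le hs (EReal.coe_le_coe_iff.2 hsL.le))
  · have hle := SparseReg.relaxObj_le_sdpObj (X := X) (y := y) (lam := lam) (mu := mu) hs.1
    have hge := fun b hb => SparseReg.sdpObj_le_relaxObj_of_sdpOptimal hlam hk hs (a := b) hb
    exact ⟨hs.1, ⟨hs.1.base, fun b hb => hle.trans (hge b hb)⟩,
      SparseReg.relaxObj_eq_coe_add_iff.1 (le_antisymm hle (hge _ hs.1.base))⟩
  · obtain ⟨b, hb, hbtop⟩ := SparseReg.exists_feasible_relaxObj_ne_top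
      (X := X) (y := y) (lam := lam) (mu := mu) (k := k) (T := T)
    have hfin : SparseReg.phi (SparseReg.gram X lam) T a.z a.β ≠ ⊤ := by
      intro htop
      refine hbtop (top_le_iff.1 ((ha.2 b hb).trans' (le_of_eq ?_)))
      rw [SparseReg.relaxObj, htop, EReal.add_top_of_ne_bot (EReal.coe_ne_bot _)]
    obtain ⟨w, B, hB, hBeq⟩ :=
      SparseReg.exists_isLift_matInner_eq_phi hpd (fun i => (ha.1.z_mem i).1) hfin
    exact ⟨w, B, SparseReg.sdpOptimal_of_relaxOptimal ⟨ha.1, hB⟩ ha hBeq⟩
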